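/- Let $d\ge 1$ and $1\le p,q\le\infty$ with $p\neq q$. Fix a non-zero window $g\in\mathcal S(\mathbb R^d)$ and, for $f\in\mathcal S'(\mathbb R^d)$, let $$V_gf(x,\eta)=\langle f,M_\eta T_xg\rangle=\int_{\mathbb R^d} f(t)\,\overline{g(t-x)}\,e^{-2\pi i\eta\cdot t}\,dt,\qquad x,\eta\in\mathbb R^d,$$ be its short-time Fourier transform, where $M_\eta T_xg(t)=e^{2\pi i\eta\cdot t}g(t-x)$ and $\langle f,\varphi\rangle$ is the pairing of $f\in\mathcal S'$ with $\varphi\in\mathcal S$ that extends $\int f\overline{\varphi}$ (the integral being understood in this sense). Put $$\|f\|_{M^{p,q}}=\left(\int_{\mathbb R^d}\Big(\int_{\mathbb R^d}|V_gf(x,\eta)|^p\,dx\Big)^{q/p}d\eta\right)^{1/q}\in[0,\infty],$$ with the usual essential suprema if $p=\infty$ or $q=\infty$, and let $M^{p,q}=M^{p,q}(\mathbb R^d)=\{f\in\mathcal S'(\mathbb R^d):\|f\|_{M^{p,q}}<\infty\}$. Then the chirp multiplication $Uf(x)=e^{\pi i|x|^2}f(x)$, acting on $\mathcal S'(\mathbb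 R^d)$, is unbounded on $M^{p,q}$: there is no constant $C\geq 0$ such that $$\|Uf\|_{M^{p,q}}\le C\,\|f\|_{M^{p,q}}\qquad\text{for all } f\in M^{p,q}.$$ The same holds if $M^{p,q}$ is replaced by the closure of $\mathcal S(\mathbb R^d)$ in $M^{p,q}$: no constant $C\ge 0$ satisfies this inequality for all $f$ in that closure. -/

import Mathlib

open MeasureTheory Complex
open scoped SchwartzMap ENNReal NNReal

noncomputable section

namespace ModulationSpaces

/-- `t ↦ e^{i t}` has temperate growth. -/
theorem hasTemperateGrowth_exp_I :
    (fun t : ℝ => Complex.exp (Complex.I * (t : ℂ))).HasTemperateGrowth := by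
  have hd : ∀ n : ℕ, iteratedDeriv n (fun t : ℝ => Complex.exp (Complex.I * (t : ℂ))) =
      fun t : ℝ => Complex.I ^ n * Complex.exp (Complex.I * (t : ℂ)) := by
    intro n
    induction n with
    | zero => simp
    | succ n ih =>
      rw [iteratedDeriv_succ, ih]
      funext t
      have h1 : HasDerivAt (fun t : ℝ => Complex.I * (t : ℂ)) Complex.I t := by
        simpa using (Complex.ofRealCLM.hasDerivAt (x := t)).const_mul Complex.I
      rw [(h1.cexp.const_mul (Complex.I ^ n)).deriv]
      ring
  refine ⟨?_, fun n => ⟨0, 1, fun t => ?_⟩⟩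
  · exact (contDiff_const.mul Complex.ofRealCLM.contDiff).cexp
  · rw [norm_iteratedFDeriv_eq_norm_iteratedDeriv, hd n]
    simp [mul_comm Complex.I, Complex.norm_exp_ofReal_mul_I]

/-- The character `t ↦ e^{2πi η·t}`. -/
def character {d : ℕ} (η : EuclideanSpace ℝ (Fin d)) (t : EuclideanSpace ℝ (Fin d)) : ℂ :=
  Complex.exp (2 * Real.pi * Complex.I * ((inner ℝ η t : ℝ) : ℂ))

/-- The chirp `t ↦ e^{πi |t|²}`. -/
def chirp {d : ℕ} (t : EuclideanSpace ℝ (Fin d)) : ℂ :=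
  Complex.exp (Real.pi * Complex.I * ((‖t‖ ^ 2 : ℝ) : ℂ))

theorem hasTemperateGrowth_character {d : ℕ} (η : EuclideanSpace ℝ (Fin d)) :
    (character η).HasTemperateGrowth := by
  have h : (fun t : EuclideanSpace ℝ (Fin d) =>
      (2 * Real.pi) * inner ℝ η t).HasTemperateGrowth :=
    (Function.HasTemperateGrowth.const (2 * Real.pi)).mul
      (Function.hasTemperateGrowth_inner_right η)
  convert hasTemperateGrowth_exp_I.comp h using 1
  funext t
  simp only [character, Function.comp_apply]
  congr 1
  push_cast
  ring

theorem hasTemperateGrowth_chirp {d : ℕ} :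
    (chirp (d := d)).HasTemperateGrowth := by
  have h : (fun t : EuclideanSpace ℝ (Fin d) => Real.pi * ‖t‖ ^ 2).HasTemperateGrowth :=
    (Function.HasTemperateGrowth.const Real.pi).mul
      (Function.hasTemperateGrowth_norm_sq _)
  convert hasTemperateGrowth_exp_I.comp h using 1
  funext t
  simp only [chirp, Function.comp_apply]
  congr 1
  push_cast
  ring

/-- The time-frequency shift `M_η T_x g`, that is `t ↦ e^{2πi η·t} g(t - x)`. -/
def tfShift {d : ℕ} (x η : EuclideanSpace ℝ (Fin d)) (g : 𝓢(EuclideanSpace ℝ (Fin d), ℂ)) :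
    𝓢(EuclideanSpace ℝ (Fin d), ℂ) :=
  SchwartzMap.smulLeftCLM ℂ (character η) (SchwartzMap.compSubConstCLM ℂ x g)

theorem tfShift_apply {d : ℕ} (x η : EuclideanSpace ℝ (Fin d))
    (g : 𝓢(EuclideanSpace ℝ (Fin d), ℂ)) (t : EuclideanSpace ℝ (Fin d)) :
    tfShift x η g t = character η t * g (t - x) := by
  simp [tfShift, hasTemperateGrowth_character η]

/-- The complex conjugate of a Schwartz function. -/
def conjSchwartz {d : ℕ} (g : 𝓢(EuclideanSpace ℝ (Fin d), ℂ)) :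
    𝓢(EuclideanSpace ℝ (Fin d), ℂ) :=
  SchwartzMap.postcompCLM (𝕜 := ℝ) (Complex.conjCLE : ℂ →L[ℝ] ℂ) g

/-- The short-time Fourier transform `V_g f(x, η) = ⟨f, M_η T_x g⟩` of a tempered distribution `f`.
The bracket is conjugate-linear in its second argument, so it is the value of `f` at the conjugate
of `M_η T_x g`. -/
def stft {d : ℕ} (g : 𝓢(EuclideanSpace ℝ (Fin d), ℂ)) (f : 𝓢'(EuclideanSpace ℝ (Fin d), ℂ))
    (x η : EuclideanSpace ℝ (Fin d)) : ℂ :=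
  f (conjSchwartz (tfShift x η g))

/-- For a Schwartz function `f`, `V_g f(x, η) = ∫ f(t) conj(g(t - x)) e^{-2πi η·t} dt`. -/
theorem stft_toTemperedDistribution {d : ℕ} (g f : 𝓢(EuclideanSpace ℝ (Fin d), ℂ))
    (x η : EuclideanSpace ℝ (Fin d)) :
    stft g (SchwartzMap.toTemperedDistributionCLM (EuclideanSpace ℝ (Fin d)) ℂ volume f) x η =
      ∫ t, f t * (starRingEnd ℂ) (g (t - x)) *
        Complex.exp (-(2 * Real.pi * Complex.I * ((inner ℝ η t : ℝ) : ℂ))) := by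
  refine (SchwartzMap.toTemperedDistributionCLM_apply_apply volume f
    (conjSchwartz (tfShift x η g))).trans ?_
  refine integral_congr_ae (Filter.Eventually.of_forall fun t => ?_)
  have h : conjSchwartz (tfShift x η g) t = (starRingEnd ℂ) (tfShift x η g t) := rfl
  simp only [h, tfShift_apply, character, map_mul, ← Complex.exp_conj, Complex.conj_I,
    Complex.conj_ofReal, smul_eq_mul, Complex.conj_ofNat]
  ring_nf

/-- The `M^{p,q}` norm with window `g`, with values in `[0, ∞]`: the `L^q` norm in `η` of the
`L^p` norm in `x` of `V_g f(x, η)`. -/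
def modNorm {d : ℕ} (g : 𝓢(EuclideanSpace ℝ (Fin d), ℂ)) (p q : ℝ≥0∞)
    (f : 𝓢'(EuclideanSpace ℝ (Fin d), ℂ)) : ℝ≥0∞ :=
  eLpNorm (fun η : EuclideanSpace ℝ (Fin d) =>
    eLpNorm (fun x : EuclideanSpace ℝ (Fin d) => stft g f x η) p volume) q volume

/-- The modulation space `M^{p,q}`: all tempered distributions with finite `M^{p,q}` norm. -/
def modulationSpace {d : ℕ} (g : 𝓢(EuclideanSpace ℝ (Fin d), ℂ)) (p q : ℝ≥0∞) :
    Set 𝓢'(EuclideanSpace ℝ (Fin d), ℂ) :=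
  {f | modNorm g p q f < ∞}

/-- The closure of the Schwartz class in `M^{p,q}`. -/
def schwartzClosure {d : ℕ} (g : 𝓢(EuclideanSpace ℝ (Fin d), ℂ)) (p q : ℝ≥0∞) :
    Set 𝓢'(EuclideanSpace ℝ (Fin d), ℂ) :=
  {f | f ∈ modulationSpace g p q ∧ ∀ ε : ℝ≥0∞, 0 < ε →
    ∃ φ : 𝓢(EuclideanSpace ℝ (Fin d), ℂ), modNorm g p q
      (f - SchwartzMap.toTemperedDistributionCLM (EuclideanSpace ℝ (Fin d)) ℂ volume φ) < ε}

/-- The chirp multiplication `U f(x) = e^{πi |x|²} f(x)` on tempered distributions. -/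
def chirpMul {d : ℕ} :
    𝓢'(EuclideanSpace ℝ (Fin d), ℂ) →L[ℂ] 𝓢'(EuclideanSpace ℝ (Fin d), ℂ) :=
  TemperedDistribution.smulLeftCLM ℂ chirp

/-- `chirpMul` is pointwise multiplication by the chirp on Schwartz functions. -/
theorem chirpMul_toTemperedDistribution {d : ℕ} (f : 𝓢(EuclideanSpace ℝ (Fin d), ℂ)) :
    chirpMul (SchwartzMap.toTemperedDistributionCLM (EuclideanSpace ℝ (Fin d)) ℂ volume f) =
      SchwartzMap.toTemperedDistributionCLM (EuclideanSpace ℝ (Fin d)) ℂ volume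
        (SchwartzMap.smulLeftCLM ℂ chirp f) := by
  ext φ
  refine (SchwartzMap.toTemperedDistributionCLM_apply_apply volume f
    (SchwartzMap.smulLeftCLM ℂ chirp φ)).trans
    (Eq.trans ?_ (SchwartzMap.toTemperedDistributionCLM_apply_apply volume
      (SchwartzMap.smulLeftCLM ℂ chirp f) φ).symm)
  refine integral_congr_ae (Filter.Eventually.of_forall fun t => ?_)
  simp only [SchwartzMap.smulLeftCLM_apply_apply hasTemperateGrowth_chirp, smul_eq_mul]
  ring

/-- `T` is bounded on the space `X` with respect to the `M^{p,q}` norm. As norms take values in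
`[0, ∞]`, the inequality includes that `T f` has finite norm for every `f` in
`X ⊆ M^{p,q}`. -/
def IsBoundedOn {d : ℕ} (g : 𝓢(EuclideanSpace ℝ (Fin d), ℂ)) (p q : ℝ≥0∞)
    (X : Set 𝓢'(EuclideanSpace ℝ (Fin d), ℂ))
    (T : 𝓢'(EuclideanSpace ℝ (Fin d), ℂ) →L[ℂ] 𝓢'(EuclideanSpace ℝ (Fin d), ℂ)) : Prop :=
  ∃ C : ℝ≥0, ∀ f ∈ X, modNorm g p q (T f) ≤ C * modNorm g p q f

end ModulationSpaces

end

/-!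
For a slowly varying function `f_ε(t) = φ(εt)`, the short-time Fourier transform is concentrated
where `|x| ≲ 1/ε` and `|η - η₀| ≲ 1`, uniformly in `ε`, so that the `M^{p,q}` norm of `f_ε` is
comparable to `ε^{-d/p}`. Multiplication by the chirp of rate `s = ±1` shears phase space: the
transform is now concentrated where `|x| ≲ 1/ε` and `|η - s x - η₀| ≲ 1`, that is, `η` ranges over
a ball of radius about `1/ε` and `x`, for given `η`, over a ball of radius about `1`, so that the
norm is comparable to `ε^{-d/q}`. Hence, as `ε → 0`, chirp multiplication `U` inflates the norm of
`f_ε` if `p > q`, and that of `U⁻¹ f_ε` if `p < q`.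
-/

noncomputable section

namespace ModulationSpaces

open Filter Topology Module
open scoped FourierTransform RealInnerProductSpace ComplexConjugate

section Decay

variable {E : Type*} [NormedAddCommGroup E]

/-- The weight `(1 + ‖x‖)⁻¹`, whose powers measure polynomial decay. -/
def decay (x : E) : ℝ := (1 + ‖x‖)⁻¹

theorem decay_pos (x : E) : 0 < decay x := by
  unfold decay; positivity

theorem decay_le_one (x : E) : decay x ≤ 1 :=
  inv_le_one_of_one_le₀ (by simp)

theorem continuous_decay : Continuous (decay (E := E)) :=
  Continuous.inv₀ (by fun_prop) fun x => by positivity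

theorem decay_neg (x : E) : decay (-x) = decay x := by
  simp [decay]

theorem decay_mul_decay_le (x y : E) : decay x * decay y ≤ decay (x + y) := by
  rw [decay, decay, decay, ← mul_inv]
  gcongr
  nlinarith [norm_add_le x y, norm_nonneg x, norm_nonneg y]

variable [NormedSpace ℝ E]

theorem decay_le_decay_smul {c : ℝ} (hc : |c| ≤ 1) (x : E) : decay x ≤ decay (c • x) := by
  unfold decay
  gcongr
  rw [norm_smul]
  exact mul_le_of_le_one_left (norm_nonneg x) hc

theorem norm_sub_smul_comm {s : ℝ} (hs : |s| = 1) (x y : E) : ‖x - s • y‖ = ‖y - s • x‖ := by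
  rcases eq_or_eq_neg_of_abs_eq hs with rfl | rfl
  · simpa using norm_sub_rev x y
  · simp [add_comm]

theorem norm_smul_le_norm_sub_smul_add {s ε : ℝ} (hs : |s| = 1) (hε : |ε| ≤ 1) (x y : E) :
    ‖ε • x‖ ≤ ‖x - s • y‖ + ‖ε • y‖ :=
  calc ‖ε • x‖ = ‖ε • (x - s • y) + s • ε • y‖ := by
        rw [smul_sub, smul_comm s ε, sub_add_cancel]
    _ ≤ ‖x - s • y‖ + ‖ε • y‖ := by
        refine (norm_add_le _ _).trans (add_le_add ?_ ?_)
        · rw [norm_smul, Real.norm_eq_abs]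
          exact mul_le_of_le_one_left (norm_nonneg _) hε
        · rw [norm_smul, Real.norm_eq_abs, hs, one_mul]

theorem decay_smul_mul_decay_sub_smul_le {s ε : ℝ} (hs : |s| = 1) (hε : |ε| ≤ 1) (x y : E) :
    decay (ε • x) * decay (y - s • x) ≤ decay (ε • y) :=
  calc decay (ε • x) * decay (y - s • x) ≤ decay (ε • s • x) * decay (ε • (y - s • x)) := by
        have hsx : decay (ε • s • x) = decay (ε • x) := by
          simp only [decay, norm_smul, Real.norm_eq_abs, hs, one_mul]
        rw [hsx]
        exact mul_le_mul_of_nonneg_left (decay_le_decay_smul hε _) (decay_pos _).le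
    _ ≤ decay (ε • y) := by
        simpa [smul_sub] using decay_mul_decay_le (ε • s • x) (ε • (y - s • x))

variable [FiniteDimensional ℝ E] [MeasurableSpace E] [BorelSpace E] (μ : Measure E)
  [μ.IsAddHaarMeasure]

theorem eventually_memLp_decay_pow {p : ℝ≥0∞} (hp : p ≠ 0) :
    ∀ᶠ n : ℕ in atTop, MemLp (fun x : E => decay x ^ n) p μ := by
  have hmeas (n : ℕ) : AEStronglyMeasurable (fun x : E => decay x ^ n) μ :=
    (continuous_decay.pow n).aestronglyMeasurable
  rcases eq_or_ne p ∞ with rfl | hp'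
  · refine .of_forall fun n => memLp_top_of_bound (hmeas n) 1 (.of_forall fun x => ?_)
    rw [Real.norm_of_nonneg (pow_nonneg (decay_pos x).le n)]
    exact pow_le_one₀ (decay_pos x).le (decay_le_one x)
  have hp0 : 0 < p.toReal := ENNReal.toReal_pos hp hp'
  filter_upwards [tendsto_natCast_atTop_atTop.eventually_gt_atTop (finrank ℝ E / p.toReal)]
    with n hn
  rw [← integrable_norm_rpow_iff (hmeas n) hp hp']
  refine (integrable_one_add_norm ((div_lt_iff₀ hp0).1 hn)).congr (.of_forall fun x => ?_)
  have h1 : 0 ≤ 1 + ‖x‖ := by positivity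
  simp only
  rw [Real.norm_of_nonneg (pow_nonneg (decay_pos x).le n), decay, inv_pow,
    Real.inv_rpow (by positivity), ← Real.rpow_natCast, ← Real.rpow_mul h1, Real.rpow_neg h1]

end Decay

section Growth

theorem eventually_mul_rpow_lt_mul_rpow {c K : ℝ≥0∞} (hc : c ≠ 0) (hK : K ≠ ∞) {α β : ℝ}
    (h : β < α) : ∀ᶠ t : ℝ≥0∞ in 𝓝[≠] ∞, K * t ^ β < c * t ^ α := by
  have hlim : ∀ᶠ t : ℝ≥0∞ in 𝓝 ∞, K / c < t ^ (α - β) :=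
    (ENNReal.tendsto_rpow_at_top (sub_pos.2 h)).eventually_const_lt (ENNReal.div_lt_top hK hc)
  filter_upwards [nhdsWithin_le_nhds hlim, self_mem_nhdsWithin,
    nhdsWithin_le_nhds (lt_mem_nhds ENNReal.zero_lt_top)] with t hlt ht ht0
  have hb0 : t ^ β ≠ 0 := (ENNReal.rpow_pos ht0 ht).ne'
  have hbt : t ^ β ≠ ∞ := ENNReal.rpow_ne_top_of_ne_zero ht0.ne' ht
  calc K * t ^ β < t ^ (α - β) * c * t ^ β :=
        ENNReal.mul_lt_mul_left hb0 hbt ((ENNReal.div_lt_iff (.inl hc) (.inr hK)).1 hlt)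
    _ = c * t ^ α := by
        rw [mul_right_comm, ← ENNReal.rpow_add _ _ ht0.ne' ht, sub_add_cancel, mul_comm]

theorem eventually_abs_lt {r : ℝ} (hr : 0 < r) : ∀ᶠ ε : ℝ in 𝓝[≠] 0, |ε| < r :=
  nhdsWithin_le_nhds <| (eventually_abs_sub_lt 0 hr).mono fun ε hε => by simpa using hε

theorem toReal_inv_lt_toReal_inv {p q : ℝ≥0∞} (hp : p ≠ 0) (h : p < q) :
    q⁻¹.toReal < p⁻¹.toReal :=
  ENNReal.toReal_strict_mono (ENNReal.inv_ne_top.2 hp) (ENNReal.inv_lt_inv.2 h)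

end Growth

section VolumeScale

variable (E : Type*) [NormedAddCommGroup E] [NormedSpace ℝ E]

/-- The factor `|ε|⁻ⁿ`, with `n` the dimension of `E`, by which taking preimages under `x ↦ ε • x`
multiplies volumes. -/
def volumeScale (ε : ℝ) : ℝ≥0∞ := ENNReal.ofReal |(ε ^ finrank ℝ E)⁻¹|

theorem volumeScale_ne_zero {ε : ℝ} (hε : ε ≠ 0) : volumeScale E ε ≠ 0 := by
  simpa [volumeScale] using pow_pos (abs_pos.2 hε) _

theorem volumeScale_ne_top (ε : ℝ) : volumeScale E ε ≠ ∞ :=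
  ENNReal.ofReal_ne_top

theorem tendsto_volumeScale [FiniteDimensional ℝ E] [Nontrivial E] :
    Tendsto (volumeScale E) (𝓝[≠] 0) (𝓝[≠] ∞) := by
  refine tendsto_nhdsWithin_iff.2 ⟨?_, .of_forall (volumeScale_ne_top E)⟩
  have hpow : Tendsto (fun ε : ℝ => ε ^ finrank ℝ E) (𝓝[≠] 0) (𝓝[≠] 0) := by
    refine tendsto_nhdsWithin_iff.2 ⟨?_, ?_⟩
    · simpa [finrank_pos.ne'] using
        (continuous_pow (finrank ℝ E)).continuousWithinAt (x := (0 : ℝ)).tendsto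
    · filter_upwards [self_mem_nhdsWithin] with ε hε using pow_ne_zero _ hε
  exact ENNReal.tendsto_ofReal_atTop.comp (tendsto_norm_inv_nhdsNE_zero_atTop.comp hpow)

theorem eventually_lt_of_volumeScale_bounds [FiniteDimensional ℝ E] [Nontrivial E]
    {F G : ℝ → ℝ≥0∞} {α β : ℝ} (h : β < α)
    (hF : ∃ K ≠ ∞, ∀ᶠ ε in 𝓝[≠] 0, F ε ≤ K * volumeScale E ε ^ β)
    (hG : ∃ c ≠ 0, ∀ᶠ ε in 𝓝[≠] 0, c * volumeScale E ε ^ α ≤ G ε) (C : ℝ≥0) :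
    ∀ᶠ ε in 𝓝[≠] 0, F ε < ∞ ∧ C * F ε < G ε := by
  obtain ⟨K, hK, hF⟩ := hF
  obtain ⟨c, hc, hG⟩ := hG
  have hCK : C * K ≠ ∞ := ENNReal.mul_ne_top ENNReal.coe_ne_top hK
  filter_upwards [hF, hG, (tendsto_volumeScale E).eventually
    (eventually_mul_rpow_lt_mul_rpow hc hCK h), self_mem_nhdsWithin] with ε hFε hGε hlt hε
  have hpow : volumeScale E ε ^ β ≠ ∞ :=
    ENNReal.rpow_ne_top_of_ne_zero (volumeScale_ne_zero E hε) (volumeScale_ne_top E ε)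
  refine ⟨hFε.trans_lt (ENNReal.mul_lt_top hK.lt_top hpow.lt_top), ?_⟩
  calc C * F ε ≤ C * (K * volumeScale E ε ^ β) := by gcongr
    _ = C * K * volumeScale E ε ^ β := (mul_assoc _ _ _).symm
    _ < c * volumeScale E ε ^ α := hlt
    _ ≤ G ε := hGε

variable {E} [FiniteDimensional ℝ E] [MeasurableSpace E] [BorelSpace E]

theorem measure_preimage_smul_ball (μ : Measure E) [μ.IsAddHaarMeasure] {ε : ℝ} (hε : ε ≠ 0)
    (x : E) (r : ℝ) :
    μ ((ε • ·) ⁻¹' Metric.ball x r) = volumeScale E ε * μ (Metric.ball 0 r) := by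
  rw [Measure.addHaar_preimage_smul _ hε, Measure.addHaar_ball_center, volumeScale]

end VolumeScale

section LpNorms

variable {E F : Type*} [NormedAddCommGroup E] [NormedSpace ℝ E] [FiniteDimensional ℝ E]
  [MeasurableSpace E] [BorelSpace E] [NormedAddCommGroup F]

theorem eLpNorm_comp_smul (μ : Measure E) [μ.IsAddHaarMeasure] {c : ℝ} (hc : c ≠ 0) (f : E → F)
    (p : ℝ≥0∞) :
    eLpNorm (fun x => f (c • x)) p μ =
      volumeScale E c ^ p⁻¹.toReal * eLpNorm f p μ := by
  have hemb : MeasurableEmbedding (c • · : E → E) :=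
    (Homeomorph.smulOfNeZero c hc).measurableEmbedding
  rw [← one_div p, ← smul_eq_mul, ← eLpNorm_smul_measure_of_ne_zero (volumeScale_ne_zero E hc),
    volumeScale, ← Measure.map_addHaar_smul μ hc, hemb.eLpNorm_map_measure]
  rfl

theorem mul_rpow_measure_le_eLpNorm {α ε : Type*} [MeasurableSpace α] [TopologicalSpace ε]
    [ContinuousENorm ε] {μ : Measure α} {f : α → ε} {c p : ℝ≥0∞} {s : Set α}
    (hs : MeasurableSet s) (hs0 : μ s ≠ 0) (hp : p ≠ 0) (h : ∀ x ∈ s, c ≤ ‖f x‖ₑ) :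
    c * μ s ^ p⁻¹.toReal ≤ eLpNorm f p μ := by
  calc c * μ s ^ p⁻¹.toReal = eLpNorm (s.indicator fun _ => c) p μ := by
        rw [eLpNorm_indicator_const' hs hs0 hp, enorm_eq_self, ENNReal.toReal_inv, one_div]
    _ ≤ eLpNorm f p μ := by
        refine eLpNorm_mono_enorm fun x => ?_
        by_cases hx : x ∈ s <;> simp [hx, h]

variable {α β : Type*} [MeasurableSpace α] [MeasurableSpace β] {μ : Measure α} {ν : Measure β}
  {p q : ℝ≥0∞} {G : α → β → F}

theorem eLpNorm_eLpNorm_le_mul {u : β → ℝ} {v : β → α → ℝ} {K : ℝ≥0∞} (hK : K ≠ ∞)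
    (hG : ∀ x y, ‖G x y‖ ≤ u y * v y x) (hv : ∀ y, eLpNorm (v y) p μ ≤ K) :
    eLpNorm (fun y => eLpNorm (fun x => G x y) p μ) q ν ≤ K * eLpNorm u q ν := by
  lift K to ℝ≥0 using hK
  refine eLpNorm_le_nnreal_smul_eLpNorm_of_ae_le_mul' (.of_forall fun y => ?_) q
  calc ‖eLpNorm (fun x => G x y) p μ‖ₑ ≤ eLpNorm (u y • v y) p μ := by
        rw [enorm_eq_self]; exact eLpNorm_mono_real (hG · y)
    _ ≤ K * ‖u y‖ₑ := by rw [eLpNorm_const_smul, mul_comm]; gcongr; exact hv y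

theorem le_eLpNorm_eLpNorm {c a : ℝ≥0∞} {s : β → Set α} {t : Set β} (hp : p ≠ 0) (hq : q ≠ 0)
    (ha : a ≠ 0) (hs : ∀ y ∈ t, MeasurableSet (s y)) (hsa : ∀ y ∈ t, μ (s y) = a)
    (ht : MeasurableSet t) (ht0 : ν t ≠ 0) (hG : ∀ y ∈ t, ∀ x ∈ s y, c ≤ ‖G x y‖ₑ) :
    c * a ^ p⁻¹.toReal * ν t ^ q⁻¹.toReal ≤
      eLpNorm (fun y => eLpNorm (fun x => G x y) p μ) q ν := by
  refine mul_rpow_measure_le_eLpNorm ht ht0 hq fun y hy => ?_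
  rw [enorm_eq_self, ← hsa y hy]
  exact mul_rpow_measure_le_eLpNorm (hs y hy) (by rwa [hsa y hy]) hp (hG y hy)

end LpNorms

section RescaledStft

theorem exists_norm_le_decay_pow {E F : Type*} [NormedAddCommGroup E] [NormedSpace ℝ E]
    [NormedAddCommGroup F] [NormedSpace ℝ F] (f : 𝓢(E, F)) (n : ℕ) :
    ∃ C, 0 ≤ C ∧ ∀ x, ‖f x‖ ≤ C * decay x ^ n := by
  refine ⟨2 ^ n * (Finset.Iic (n, 0)).sup (fun m => SchwartzMap.seminorm ℝ m.1 m.2) f,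
    by positivity, fun x => ?_⟩
  have h := SchwartzMap.one_add_le_sup_seminorm_apply (𝕜 := ℝ) (m := (n, 0)) le_rfl le_rfl f x
  rw [norm_iteratedFDeriv_zero] at h
  rwa [decay, inv_pow, ← div_eq_mul_inv, le_div_iff₀ (by positivity), mul_comm]

variable {E : Type*} [NormedAddCommGroup E] [InnerProductSpace ℝ E] [FiniteDimensional ℝ E]
  [MeasurableSpace E] [BorelSpace E]

theorem exists_integral_norm_mul_norm_le (f h : 𝓢(E, ℂ)) (n : ℕ) :
    ∃ C, 0 ≤ C ∧ ∀ ε : ℝ, |ε| ≤ 1 → ∀ y, ∫ s, ‖f s‖ * ‖h (ε • s + y)‖ ≤ C * decay y ^ n := by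
  obtain ⟨m, hm⟩ := (eventually_memLp_decay_pow (volume : Measure E) one_ne_zero).exists
  rw [memLp_one_iff_integrable] at hm
  obtain ⟨A, hA, hf⟩ := exists_norm_le_decay_pow f (n + m)
  obtain ⟨B, hB, hh⟩ := exists_norm_le_decay_pow h n
  refine ⟨A * B * ∫ s : E, decay s ^ m, mul_nonneg (mul_nonneg hA hB)
    (integral_nonneg fun s => pow_nonneg (decay_pos s).le m), fun ε hε y => ?_⟩
  have hpos (z : E) := (decay_pos z).le
  have hdecay (s : E) : decay s * decay (ε • s + y) ≤ decay y :=
    calc decay s * decay (ε • s + y) ≤ decay (-(ε • s)) * decay (ε • s + y) := by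
          rw [decay_neg]
          exact mul_le_mul_of_nonneg_right (decay_le_decay_smul hε s) (hpos _)
      _ ≤ decay y := by simpa using decay_mul_decay_le (-(ε • s)) (ε • s + y)
  have hle (s : E) : ‖f s‖ * ‖h (ε • s + y)‖ ≤ A * B * decay y ^ n * decay s ^ m :=
    calc ‖f s‖ * ‖h (ε • s + y)‖ ≤ A * decay s ^ (n + m) * (B * decay (ε • s + y) ^ n) :=
          mul_le_mul (hf s) (hh _) (norm_nonneg _) ((norm_nonneg _).trans (hf s))
      _ = A * B * (decay s * decay (ε • s + y)) ^ n * decay s ^ m := by ring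
      _ ≤ A * B * decay y ^ n * decay s ^ m := by
          have := hpos s
          have := hpos (ε • s + y)
          gcongr
          exact hdecay s
  calc ∫ s, ‖f s‖ * ‖h (ε • s + y)‖ ≤ ∫ s, A * B * decay y ^ n * decay s ^ m :=
        integral_mono_of_nonneg (.of_forall fun s => by positivity) (hm.const_mul _)
          (.of_forall hle)
    _ = A * B * (∫ s, decay s ^ m) * decay y ^ n := by rw [integral_const_mul]; ring

/-- The short-time Fourier transform with window `h` of the dilate `t ↦ φ (ε • t)`, at time `x` and
frequency `η`, in the variable `y = ε • x` and up to a factor of modulus one. In this form it makes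
sense, and is continuous, at `ε = 0`. -/
def rescaledStft (h φ : 𝓢(E, ℂ)) (ε : ℝ) (y η : E) : ℂ :=
  𝓕 (fun s => φ (ε • s + y) * conj (h s)) η

theorem rescaledStft_eq_integral (h φ : 𝓢(E, ℂ)) (ε : ℝ) (y η : E) :
    rescaledStft h φ ε y η = ∫ s, 𝐞 (-⟪s, η⟫) • (φ (ε • s + y) * conj (h s)) :=
  Real.fourier_eq _ _

theorem norm_rescaledStft_le_integral (h φ : 𝓢(E, ℂ)) (ε : ℝ) (y η : E) :
    ‖rescaledStft h φ ε y η‖ ≤ ∫ s, ‖h s‖ * ‖φ (ε • s + y)‖ := by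
  rw [rescaledStft_eq_integral]
  refine (norm_integral_le_integral_norm _).trans_eq (integral_congr_ae (.of_forall fun s => ?_))
  simp [Circle.norm_smul, mul_comm]

theorem rescaledStft_eq_integral_fourier (h φ : 𝓢(E, ℂ)) (ε : ℝ) (y η : E) :
    rescaledStft h φ ε y η = ∫ ζ, inner ℂ (𝓕 h (ε • ζ - η)) (𝐞 ⟪ζ, y⟫ • 𝓕 φ ζ) := by
  let L : E →ₗ[ℝ] E →ₗ[ℝ] ℝ := ε • innerₗ E
  have hL : Continuous fun z : E × E => L z.1 z.2 := by
    simp only [L, LinearMap.smul_apply, innerₗ_apply_apply]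
    fun_prop
  have hh (ζ : E) : VectorFourier.fourierIntegral 𝐞 volume L (fun s => 𝐞 ⟪s, η⟫ • h s) ζ =
      𝓕 h (ε • ζ - η) := by
    rw [SchwartzMap.fourier_coe, Real.fourier_eq]
    refine integral_congr_ae (.of_forall fun s => ?_)
    simp only [L, LinearMap.smul_apply, innerₗ_apply_apply, smul_smul, ← AddChar.map_add_eq_mul,
      inner_sub_right, real_inner_smul_right, smul_eq_mul]
    ring_nf
  have hφ (s : E) : VectorFourier.fourierIntegral 𝐞 volume (-L.flip)
      (fun ζ => 𝐞 ⟪ζ, y⟫ • 𝓕 φ ζ) s = φ (ε • s + y) := by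
    conv_rhs => rw [← FourierTransform.fourierInv_fourier_eq (F := 𝓢(E, ℂ)) φ,
      SchwartzMap.fourierInv_coe, Real.fourierInv_eq]
    refine integral_congr_ae (.of_forall fun ζ => ?_)
    simp [L, smul_smul, ← AddChar.map_add_eq_mul, inner_add_right, real_inner_smul_right,
      real_inner_comm]
  have hf : Integrable fun s => 𝐞 ⟪s, η⟫ • h s := by
    simpa using (Real.fourierIntegral_convergent_iff (-η)).2 h.integrable
  have hg : Integrable fun ζ => 𝐞 ⟪ζ, y⟫ • 𝓕 φ ζ := by
    simpa using (Real.fourierIntegral_convergent_iff (-y)).2 (𝓕 φ).integrable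
  have hflip := VectorFourier.integral_sesq_fourierIntegral_eq_neg_flip (innerSL ℂ)
    Real.continuous_fourierChar hL hf hg
  simp only [hφ, hh, innerSL_apply_apply] at hflip
  rw [hflip, rescaledStft_eq_integral]
  refine integral_congr_ae (.of_forall fun s => ?_)
  simp only [AddChar.map_neg_eq_inv, Circle.smul_def, Circle.coe_inv, smul_eq_mul,
    RCLike.inner_apply, map_mul, Circle.starRingEnd_addChar]
  ring

theorem norm_rescaledStft_le_integral_fourier (h φ : 𝓢(E, ℂ)) (ε : ℝ) (y η : E) :
    ‖rescaledStft h φ ε y η‖ ≤ ∫ ζ, ‖𝓕 φ ζ‖ * ‖𝓕 h (ε • ζ + -η)‖ := by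
  rw [rescaledStft_eq_integral_fourier]
  refine (norm_integral_le_integral_norm _).trans_eq (integral_congr_ae (.of_forall fun ζ => ?_))
  simp [Circle.norm_smul, sub_eq_add_neg]

theorem exists_norm_rescaledStft_le (h φ : 𝓢(E, ℂ)) (n : ℕ) :
    ∃ C, 0 ≤ C ∧ ∀ ε : ℝ, |ε| ≤ 1 → ∀ y η,
      ‖rescaledStft h φ ε y η‖ ≤ C * decay y ^ n * decay η ^ n := by
  obtain ⟨A, hA, htime⟩ := exists_integral_norm_mul_norm_le h φ (2 * n)
  obtain ⟨B, hB, hfreq⟩ := exists_integral_norm_mul_norm_le (𝓕 φ) (𝓕 h) (2 * n)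
  refine ⟨A + B, by positivity, fun ε hε y η => ?_⟩
  have hy := decay_pos y
  have hη := decay_pos η
  have ha : ‖rescaledStft h φ ε y η‖ ≤ (A + B) * decay y ^ (2 * n) :=
    (norm_rescaledStft_le_integral h φ ε y η).trans <| (htime ε hε y).trans <| by
      gcongr; exact le_add_of_nonneg_right hB
  have hb : ‖rescaledStft h φ ε y η‖ ≤ (A + B) * decay η ^ (2 * n) :=
    (norm_rescaledStft_le_integral_fourier h φ ε y η).trans <| (hfreq ε hε (-η)).trans <| by
      rw [decay_neg]; gcongr; exact le_add_of_nonneg_left hA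
  refine le_of_sq_le_sq ?_ (by positivity)
  calc ‖rescaledStft h φ ε y η‖ ^ 2
      ≤ ((A + B) * decay y ^ (2 * n)) * ((A + B) * decay η ^ (2 * n)) := by
        rw [sq]; gcongr
    _ = ((A + B) * decay y ^ n * decay η ^ n) ^ 2 := by ring

theorem continuous_rescaledStft (h φ : 𝓢(E, ℂ)) :
    Continuous fun z : ℝ × E × E => rescaledStft h φ z.1 z.2.1 z.2.2 := by
  obtain ⟨C, -, hC⟩ := exists_norm_le_decay_pow φ 0
  have hφ := φ.continuous
  have hh := h.continuous
  have := Real.continuous_fourierChar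
  simp only [rescaledStft_eq_integral, Circle.smul_def]
  refine continuous_of_dominated (bound := fun s => C * ‖h s‖) (fun z => ?_) (fun z => ?_)
    (h.integrable.norm.const_mul C) (.of_forall fun s => by fun_prop)
  · exact Continuous.aestronglyMeasurable (by fun_prop)
  · refine .of_forall fun s => ?_
    simp only [norm_smul, Circle.norm_coe, one_mul, norm_mul, RCLike.norm_conj]
    gcongr
    simpa using hC (z.1 • s + z.2.1)

theorem exists_rescaledStft_zero_ne_zero {h φ : 𝓢(E, ℂ)} (hh : h ≠ 0) (hφ : φ 0 ≠ 0) :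
    ∃ η, rescaledStft h φ 0 0 η ≠ 0 := by
  by_contra! h0
  have hF : 𝓕 (fun s => φ 0 * conj (h s)) = 0 := by
    funext η
    simpa [rescaledStft] using h0 η
  have hcont : Continuous fun s => φ 0 * conj (h s) := by
    have := h.continuous
    fun_prop
  have hint : Integrable fun s => φ 0 * conj (h s) :=
    (RCLike.conjLIE.integrable_comp_iff.2 h.integrable).const_mul _
  have hinv := hcont.fourierInv_fourier_eq hint (by rw [hF]; exact integrable_zero _ _ _)
  refine hh (SchwartzMap.ext fun s => ?_)
  have hs : φ 0 * conj (h s) = 0 := by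
    rw [← congrFun hinv s, hF, Real.fourierInv_eq]
    simp
  simpa [hφ] using hs

theorem exists_le_norm_rescaledStft {h φ : 𝓢(E, ℂ)} (hh : h ≠ 0) (hφ : φ 0 ≠ 0) :
    ∃ (η₀ : E) (c r : ℝ), 0 < c ∧ 0 < r ∧ ∀ ε y η, |ε| < r → ‖y‖ < r → ‖η - η₀‖ < r →
      c ≤ ‖rescaledStft h φ ε y η‖ := by
  obtain ⟨η₀, hη₀⟩ := exists_rescaledStft_zero_ne_zero hh hφ
  have hpos : 0 < ‖rescaledStft h φ 0 0 η₀‖ := norm_pos_iff.2 hη₀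
  have hnear := (continuous_rescaledStft h φ).norm.continuousAt (x := (0, 0, η₀))
    |>.eventually_const_le (half_lt_self hpos)
  obtain ⟨r, hr, hball⟩ := Metric.eventually_nhds_iff.1 hnear
  refine ⟨η₀, _, r, half_pos hpos, hr, fun ε y η hε hy hη => hball (y := (ε, y, η)) ?_⟩
  simp [dist_eq_norm, *]

end RescaledStft

section RescaledModNorm

variable {E : Type*} [NormedAddCommGroup E] [InnerProductSpace ℝ E] [FiniteDimensional ℝ E]
  [MeasurableSpace E] [BorelSpace E]

/-- The `M^{p,q}` norm of the dilate `t ↦ φ (ε • t)` multiplied by the chirp of rate `s`, which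
shears phase space by `(x, η) ↦ (x, η - s • x)`; here `h` is the window divided by that chirp. -/
def rescaledModNorm (h φ : 𝓢(E, ℂ)) (p q : ℝ≥0∞) (s ε : ℝ) : ℝ≥0∞ :=
  eLpNorm (fun η : E => eLpNorm (fun x : E => rescaledStft h φ ε (ε • x) (η - s • x)) p volume)
    q volume

variable {h φ : 𝓢(E, ℂ)} {p q : ℝ≥0∞} {s : ℝ}

theorem exists_eventually_rescaledModNorm_zero_le (h φ : 𝓢(E, ℂ)) (hp : p ≠ 0) (hq : q ≠ 0) :
    ∃ K ≠ ∞, ∀ᶠ ε in 𝓝[≠] 0,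
      rescaledModNorm h φ p q 0 ε ≤ K * volumeScale E ε ^ p⁻¹.toReal := by
  obtain ⟨n, hnp, hnq⟩ := ((eventually_memLp_decay_pow (volume : Measure E) hp).and
    (eventually_memLp_decay_pow (volume : Measure E) hq)).exists
  obtain ⟨C, -, hC⟩ := exists_norm_rescaledStft_le h φ n
  let Dp := eLpNorm (fun x : E => decay x ^ n) p volume
  let Dq := eLpNorm (fun η : E => C * decay η ^ n) q volume
  refine ⟨Dp * Dq, ENNReal.mul_ne_top hnp.eLpNorm_ne_top (hnq.const_mul C).eLpNorm_ne_top, ?_⟩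
  filter_upwards [eventually_abs_lt one_pos, self_mem_nhdsWithin] with ε hε hε0
  have hv : eLpNorm (fun x : E => decay (ε • x) ^ n) p volume =
      volumeScale E ε ^ p⁻¹.toReal * Dp :=
    eLpNorm_comp_smul volume hε0 (fun x => decay x ^ n) p
  have hv_top : volumeScale E ε ^ p⁻¹.toReal * Dp ≠ ∞ :=
    ENNReal.mul_ne_top (ENNReal.rpow_ne_top_of_nonneg (by positivity) (volumeScale_ne_top E ε))
      hnp.eLpNorm_ne_top
  calc rescaledModNorm h φ p q 0 ε ≤ volumeScale E ε ^ p⁻¹.toReal * Dp * Dq := by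
        refine eLpNorm_eLpNorm_le_mul (v := fun _ x => decay (ε • x) ^ n) hv_top
          (fun x η => ?_) fun _ => hv.le
        simpa [mul_right_comm] using hC ε hε.le (ε • x) η
    _ = Dp * Dq * volumeScale E ε ^ p⁻¹.toReal := by ring

theorem exists_eventually_rescaledModNorm_le (h φ : 𝓢(E, ℂ)) (hp : p ≠ 0) (hq : q ≠ 0)
    (hs : |s| = 1) :
    ∃ K ≠ ∞, ∀ᶠ ε in 𝓝[≠] 0,
      rescaledModNorm h φ p q s ε ≤ K * volumeScale E ε ^ q⁻¹.toReal := by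
  obtain ⟨n, hnp, hnq⟩ := ((eventually_memLp_decay_pow (volume : Measure E) hp).and
    (eventually_memLp_decay_pow (volume : Measure E) hq)).exists
  obtain ⟨C, hC0, hC⟩ := exists_norm_rescaledStft_le h φ (2 * n)
  let Dp := eLpNorm (fun x : E => decay x ^ n) p volume
  let Dq := eLpNorm (fun η : E => C * decay η ^ n) q volume
  refine ⟨Dp * Dq, ENNReal.mul_ne_top hnp.eLpNorm_ne_top (hnq.const_mul C).eLpNorm_ne_top, ?_⟩
  filter_upwards [eventually_abs_lt one_pos, self_mem_nhdsWithin] with ε hε hε0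
  have hv (η : E) : eLpNorm (fun x : E => decay (x - s • η) ^ n) p volume = Dp :=
    eLpNorm_comp_measurePreserving hnp.aestronglyMeasurable
      (measurePreserving_sub_right volume (s • η))
  have hu : eLpNorm (fun η : E => C * decay (ε • η) ^ n) q volume =
      volumeScale E ε ^ q⁻¹.toReal * Dq :=
    eLpNorm_comp_smul volume hε0 (fun η => C * decay η ^ n) q
  have hG (x η : E) : ‖rescaledStft h φ ε (ε • x) (η - s • x)‖ ≤
      C * decay (ε • η) ^ n * decay (x - s • η) ^ n := by
    have hx := decay_pos (ε • x)
    have hη := decay_pos (η - s • x)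
    calc ‖rescaledStft h φ ε (ε • x) (η - s • x)‖
        ≤ C * decay (ε • x) ^ (2 * n) * decay (η - s • x) ^ (2 * n) := hC ε hε.le _ _
      _ = C * (decay (ε • x) * decay (η - s • x)) ^ n * decay (η - s • x) ^ n *
            decay (ε • x) ^ n := by ring
      _ ≤ C * decay (ε • η) ^ n * decay (η - s • x) ^ n * 1 := by
          have hε' := decay_pos (ε • η)
          gcongr
          · exact decay_smul_mul_decay_sub_smul_le hs hε.le x η
          · exact pow_le_one₀ hx.le (decay_le_one _)
      _ = C * decay (ε • η) ^ n * decay (x - s • η) ^ n := by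
          rw [mul_one, decay, decay, decay, norm_sub_smul_comm hs η x]
  calc rescaledModNorm h φ p q s ε ≤ Dp * (volumeScale E ε ^ q⁻¹.toReal * Dq) :=
        hu ▸ eLpNorm_eLpNorm_le_mul (u := fun η => C * decay (ε • η) ^ n) hnp.eLpNorm_ne_top hG
          fun η => (hv η).le
    _ = Dp * Dq * volumeScale E ε ^ q⁻¹.toReal := by ring

theorem mul_volume_ball_rpow_ne_zero {c r : ℝ} (hc : 0 < c) (hr : 0 < r) (x : E) (a b : ℝ) :
    ENNReal.ofReal c * volume (Metric.ball x r) ^ a * volume (Metric.ball x r) ^ b ≠ 0 := by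
  have hpow (e : ℝ) : volume (Metric.ball x r) ^ e ≠ 0 :=
    (ENNReal.rpow_pos (Metric.measure_ball_pos volume x hr) measure_ball_lt_top.ne).ne'
  exact mul_ne_zero (mul_ne_zero (ENNReal.ofReal_pos.2 hc).ne' (hpow a)) (hpow b)

theorem exists_eventually_le_rescaledModNorm_zero (hh : h ≠ 0) (hφ : φ 0 ≠ 0) (hp : p ≠ 0)
    (hq : q ≠ 0) :
    ∃ c ≠ 0, ∀ᶠ ε in 𝓝[≠] 0,
      c * volumeScale E ε ^ p⁻¹.toReal ≤ rescaledModNorm h φ p q 0 ε := by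
  obtain ⟨η₀, c, r, hc, hr, hlow⟩ := exists_le_norm_rescaledStft hh hφ
  let V := volume (Metric.ball (0 : E) r)
  have hV : V ≠ 0 := (Metric.measure_ball_pos volume 0 hr).ne'
  refine ⟨_, mul_volume_ball_rpow_ne_zero hc hr (0 : E) p⁻¹.toReal q⁻¹.toReal, ?_⟩
  filter_upwards [eventually_abs_lt hr, self_mem_nhdsWithin] with ε hε hε0
  calc ENNReal.ofReal c * V ^ p⁻¹.toReal * V ^ q⁻¹.toReal * volumeScale E ε ^ p⁻¹.toReal
      = ENNReal.ofReal c * (volumeScale E ε * V) ^ p⁻¹.toReal *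
          volume (Metric.ball η₀ r) ^ q⁻¹.toReal := by
        rw [ENNReal.mul_rpow_of_nonneg _ _ ENNReal.toReal_nonneg, Measure.addHaar_ball_center]
        ring
    _ ≤ rescaledModNorm h φ p q 0 ε := by
        refine le_eLpNorm_eLpNorm (s := fun _ => (ε • ·) ⁻¹' Metric.ball 0 r) hp hq
          (mul_ne_zero (volumeScale_ne_zero E hε0) hV)
          (fun _ _ => Metric.isOpen_ball.measurableSet.preimage (measurable_const_smul ε))
          (fun _ _ => measure_preimage_smul_ball volume hε0 0 r) Metric.isOpen_ball.measurableSet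
          (Metric.measure_ball_pos volume η₀ hr).ne' fun η hη x hx => ?_
        rw [← ofReal_norm]
        refine ENNReal.ofReal_le_ofReal (hlow ε (ε • x) _ hε ?_ ?_)
        · simpa using hx
        · simpa [dist_eq_norm] using hη

theorem exists_eventually_le_rescaledModNorm (hh : h ≠ 0) (hφ : φ 0 ≠ 0) (hp : p ≠ 0)
    (hq : q ≠ 0) (hs : |s| = 1) :
    ∃ c ≠ 0, ∀ᶠ ε in 𝓝[≠] 0,
      c * volumeScale E ε ^ q⁻¹.toReal ≤ rescaledModNorm h φ p q s ε := by
  obtain ⟨η₀, c, r, hc, hr, hlow⟩ := exists_le_norm_rescaledStft hh hφ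
  have hr2 : 0 < r / 2 := half_pos hr
  let V := volume (Metric.ball (0 : E) (r / 2))
  have hV : V ≠ 0 := (Metric.measure_ball_pos volume 0 hr2).ne'
  refine ⟨_, mul_volume_ball_rpow_ne_zero hc hr2 (0 : E) p⁻¹.toReal q⁻¹.toReal, ?_⟩
  filter_upwards [eventually_abs_lt hr, eventually_abs_lt one_pos, self_mem_nhdsWithin]
    with ε hε hε1 hε0
  have ht := measure_preimage_smul_ball volume hε0 (ε • η₀) (r / 2)
  calc ENNReal.ofReal c * V ^ p⁻¹.toReal * V ^ q⁻¹.toReal * volumeScale E ε ^ q⁻¹.toReal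
      = ENNReal.ofReal c * V ^ p⁻¹.toReal *
          volume ((ε • ·) ⁻¹' Metric.ball (ε • η₀) (r / 2)) ^ q⁻¹.toReal := by
        rw [ht, ENNReal.mul_rpow_of_nonneg _ _ ENNReal.toReal_nonneg]
        ring
    _ ≤ rescaledModNorm h φ p q s ε := by
        refine le_eLpNorm_eLpNorm (s := fun η => Metric.ball (s • (η - η₀)) (r / 2)) hp hq hV
          (fun _ _ => Metric.isOpen_ball.measurableSet)
          (fun _ _ => Measure.addHaar_ball_center _ _ _)
          (Metric.isOpen_ball.measurableSet.preimage (measurable_const_smul ε))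
          (ht ▸ mul_ne_zero (volumeScale_ne_zero E hε0) hV) fun η hη x hx => ?_
        rw [Set.mem_preimage, mem_ball_iff_norm, ← smul_sub] at hη
        rw [mem_ball_iff_norm] at hx
        rw [← ofReal_norm]
        refine ENNReal.ofReal_le_ofReal (hlow ε (ε • x) _ hε ?_ ?_)
        · exact (norm_smul_le_norm_sub_smul_add hs hε1.le x (η - η₀)).trans_lt (by linarith)
        · rw [sub_right_comm, norm_sub_smul_comm hs]
          linarith

end RescaledModNorm

section Chirps

variable {d : ℕ}

/-- A Schwartz function seen as a tempered distribution. -/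
abbrev toDist (f : 𝓢(EuclideanSpace ℝ (Fin d), ℂ)) : 𝓢'(EuclideanSpace ℝ (Fin d), ℂ) :=
  SchwartzMap.toTemperedDistributionCLM (EuclideanSpace ℝ (Fin d)) ℂ volume f

/-- The chirp `t ↦ e^{πi s |t|²}` of rate `s`. -/
def rateChirp (s : ℝ) (t : EuclideanSpace ℝ (Fin d)) : ℂ :=
  Complex.exp (((Real.pi * s * ‖t‖ ^ 2 : ℝ) : ℂ) * I)

theorem norm_rateChirp (s : ℝ) (t : EuclideanSpace ℝ (Fin d)) : ‖rateChirp s t‖ = 1 :=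
  Complex.norm_exp_ofReal_mul_I _

theorem rateChirp_add (s r : ℝ) (t : EuclideanSpace ℝ (Fin d)) :
    rateChirp (s + r) t = rateChirp s t * rateChirp r t := by
  simp only [rateChirp, ← Complex.exp_add]
  push_cast
  ring_nf

theorem rateChirp_one : rateChirp (d := d) 1 = chirp := by
  funext t
  simp only [rateChirp, chirp]
  push_cast
  ring_nf

theorem conj_rateChirp (s : ℝ) (t : EuclideanSpace ℝ (Fin d)) :
    conj (rateChirp s t) = rateChirp (-s) t := by
  simp [rateChirp, ← Complex.exp_conj]

/-- Completing the square: this identity is behind the shear of phase space. -/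
theorem rateChirp_mul_exp_neg_inner (s : ℝ) (t x η : EuclideanSpace ℝ (Fin d)) :
    rateChirp s t * Complex.exp (-(2 * Real.pi * I * ((inner ℝ η t : ℝ) : ℂ))) =
      rateChirp (-s) x * (rateChirp s (t - x) *
        Complex.exp (-(2 * Real.pi * I * ((inner ℝ (η - s • x) t : ℝ) : ℂ)))) := by
  simp only [rateChirp, ← Complex.exp_add]
  congr 1
  rw [norm_sub_sq_real, inner_sub_left, real_inner_smul_left, real_inner_comm t x]
  push_cast
  ring

theorem hasTemperateGrowth_rateChirp (s : ℝ) : (rateChirp (d := d) s).HasTemperateGrowth := by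
  have h : (fun t : EuclideanSpace ℝ (Fin d) => Real.pi * s * ‖t‖ ^ 2).HasTemperateGrowth :=
    (Function.HasTemperateGrowth.const (Real.pi * s)).mul
      (Function.hasTemperateGrowth_norm_sq _)
  convert hasTemperateGrowth_exp_I.comp h using 1
  funext t
  simp only [rateChirp, Function.comp_apply, mul_comm]

/-- Multiplication of a Schwartz function by the chirp of rate `s`. -/
def rateChirpMul (s : ℝ) (f : 𝓢(EuclideanSpace ℝ (Fin d), ℂ)) :
    𝓢(EuclideanSpace ℝ (Fin d), ℂ) :=
  SchwartzMap.smulLeftCLM ℂ (rateChirp s) f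

theorem rateChirpMul_apply (s : ℝ) (f : 𝓢(EuclideanSpace ℝ (Fin d), ℂ))
    (t : EuclideanSpace ℝ (Fin d)) : rateChirpMul s f t = rateChirp s t * f t := by
  simp [rateChirpMul, hasTemperateGrowth_rateChirp s]

theorem rateChirpMul_ne_zero (s : ℝ) {f : 𝓢(EuclideanSpace ℝ (Fin d), ℂ)} (hf : f ≠ 0) :
    rateChirpMul s f ≠ 0 := by
  obtain ⟨t, ht⟩ := DFunLike.ne_iff.1 hf
  refine DFunLike.ne_iff.2 ⟨t, ?_⟩
  rw [rateChirpMul_apply]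
  exact mul_ne_zero (Complex.exp_ne_zero _) ht

theorem chirpMul_toDist_rateChirpMul (s : ℝ) (f : 𝓢(EuclideanSpace ℝ (Fin d), ℂ)) :
    chirpMul (toDist (rateChirpMul s f)) = toDist (rateChirpMul (s + 1) f) := by
  rw [chirpMul_toTemperedDistribution]
  congr 1
  ext t
  rw [← rateChirp_one, ← rateChirpMul, rateChirpMul_apply, rateChirpMul_apply, rateChirpMul_apply,
    rateChirp_add, mul_left_comm, mul_assoc]

theorem stft_rateChirpMul (s : ℝ) (h f : 𝓢(EuclideanSpace ℝ (Fin d), ℂ))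
    (x η : EuclideanSpace ℝ (Fin d)) :
    stft h (toDist (rateChirpMul s f)) x η =
      rateChirp (-s) x * stft (rateChirpMul (-s) h) (toDist f) x (η - s • x) := by
  rw [stft_toTemperedDistribution, stft_toTemperedDistribution, ← integral_const_mul]
  refine integral_congr_ae (.of_forall fun t => ?_)
  simp only [rateChirpMul_apply, map_mul, conj_rateChirp, neg_neg]
  linear_combination (f t * conj (h (t - x))) * rateChirp_mul_exp_neg_inner s t x η

/-- The dilate `t ↦ φ (ε • t)`; a unit `ε` keeps it a Schwartz function. -/
def dilate (ε : ℝˣ) (φ : 𝓢(EuclideanSpace ℝ (Fin d), ℂ)) : 𝓢(EuclideanSpace ℝ (Fin d), ℂ) :=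
  SchwartzMap.compCLMOfContinuousLinearEquiv ℂ (ContinuousLinearEquiv.smulLeft ε) φ

theorem stft_dilate (ε : ℝˣ) (h φ : 𝓢(EuclideanSpace ℝ (Fin d), ℂ))
    (x η : EuclideanSpace ℝ (Fin d)) :
    stft h (toDist (dilate ε φ)) x η =
      𝐞 (-⟪x, η⟫) * rescaledStft h φ ε ((ε : ℝ) • x) η := by
  rw [stft_toTemperedDistribution, rescaledStft_eq_integral, ← integral_const_mul,
    ← integral_add_right_eq_self _ x]
  refine integral_congr_ae (.of_forall fun s => ?_)
  have hexp : Complex.exp (-(2 * Real.pi * I * ((inner ℝ η (s + x) : ℝ) : ℂ))) =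
      𝐞 (-⟪x, η⟫) * 𝐞 (-⟪s, η⟫) := by
    rw [Real.fourierChar_apply, Real.fourierChar_apply, ← Complex.exp_add, inner_add_right,
      real_inner_comm s, real_inner_comm x]
    push_cast
    ring_nf
  have hdilate : dilate ε φ (s + x) = φ ((ε : ℝ) • s + (ε : ℝ) • x) := by
    simp [dilate, Units.smul_def]
  simp only [hexp, hdilate, add_sub_cancel_right, Circle.smul_def, smul_eq_mul]
  ring

theorem modNorm_rateChirpMul_dilate (g φ : 𝓢(EuclideanSpace ℝ (Fin d), ℂ)) (p q : ℝ≥0∞) (s : ℝ)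
    (ε : ℝˣ) :
    modNorm g p q (toDist (rateChirpMul s (dilate ε φ))) =
      rescaledModNorm (rateChirpMul (-s) g) φ p q s ε := by
  refine congrArg (eLpNorm · q volume) (funext fun η =>
    eLpNorm_congr_norm_ae (.of_forall fun x => ?_))
  rw [stft_rateChirpMul, stft_dilate, norm_mul, norm_mul, norm_rateChirp, Circle.norm_coe, one_mul,
    one_mul]

theorem toDist_mem_schwartzClosure {g f : 𝓢(EuclideanSpace ℝ (Fin d), ℂ)} {p q : ℝ≥0∞}
    (hf : toDist f ∈ modulationSpace g p q) : toDist f ∈ schwartzClosure g p q := by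
  have hzero (x η : EuclideanSpace ℝ (Fin d)) :
      stft g (0 : 𝓢'(EuclideanSpace ℝ (Fin d), ℂ)) x η = 0 := rfl
  exact ⟨hf, fun ε hε => ⟨f, by simpa [modNorm, hzero] using hε⟩⟩

theorem exists_rate_eventually_rescaledModNorm_lt (hd : 1 ≤ d) {p q : ℝ≥0∞} (hp : p ≠ 0)
    (hq : q ≠ 0) (hpq : p ≠ q) {g φ : 𝓢(EuclideanSpace ℝ (Fin d), ℂ)} (hg : g ≠ 0) (hφ : φ 0 ≠ 0)
    (C : ℝ≥0) :
    ∃ s : ℝ, ∀ᶠ ε in 𝓝[≠] 0, rescaledModNorm (rateChirpMul (-s) g) φ p q s ε < ∞ ∧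
      C * rescaledModNorm (rateChirpMul (-s) g) φ p q s ε <
        rescaledModNorm (rateChirpMul (-(s + 1)) g) φ p q (s + 1) ε := by
  have : Nonempty (Fin d) := ⟨⟨0, hd⟩⟩
  have hg' (s : ℝ) : rateChirpMul s g ≠ 0 := rateChirpMul_ne_zero s hg
  rcases hpq.lt_or_gt with hlt | hgt
  · refine ⟨-1, eventually_lt_of_volumeScale_bounds _ (toReal_inv_lt_toReal_inv hp hlt)
      (exists_eventually_rescaledModNorm_le _ φ hp hq (by simp)) ?_ C⟩
    rw [neg_add_cancel]
    exact exists_eventually_le_rescaledModNorm_zero (hg' _) hφ hp hq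
  · refine ⟨0, eventually_lt_of_volumeScale_bounds _ (toReal_inv_lt_toReal_inv hq hgt)
      (exists_eventually_rescaledModNorm_zero_le _ φ hp hq) ?_ C⟩
    exact exists_eventually_le_rescaledModNorm (hg' _) hφ hp hq (by simp)

theorem exists_modNorm_lt_modNorm_chirpMul (hd : 1 ≤ d) {p q : ℝ≥0∞} (hp : p ≠ 0) (hq : q ≠ 0)
    (hpq : p ≠ q) {g : 𝓢(EuclideanSpace ℝ (Fin d), ℂ)} (hg : g ≠ 0) (C : ℝ≥0) :
    ∃ f : 𝓢(EuclideanSpace ℝ (Fin d), ℂ), toDist f ∈ modulationSpace g p q ∧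
      C * modNorm g p q (toDist f) < modNorm g p q (chirpMul (toDist f)) := by
  obtain ⟨t, ht⟩ := DFunLike.ne_iff.1 hg
  let φ := SchwartzMap.compSubConstCLM ℂ (-t) g
  have hφ : φ 0 ≠ 0 := by simpa [φ] using ht
  obtain ⟨s, hs⟩ := exists_rate_eventually_rescaledModNorm_lt hd hp hq hpq hg hφ C
  obtain ⟨ε, ⟨hfin, hlt⟩, hε⟩ := (hs.and self_mem_nhdsWithin).exists
  refine ⟨rateChirpMul s (dilate (Units.mk0 ε hε) φ), ?_, ?_⟩
  · rwa [modulationSpace, Set.mem_ofPred_eq, modNorm_rateChirpMul_dilate]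
  · rwa [chirpMul_toDist_rateChirpMul, modNorm_rateChirpMul_dilate, modNorm_rateChirpMul_dilate]

end Chirps

end ModulationSpaces

end

open ModulationSpaces in
theorem proposition7p1_general (d : ℕ) (hd : 1 ≤ d) (p q : ℝ≥0∞) (hp : p ≠ 0) (hq : q ≠ 0)
    (hpq : p ≠ q) (g : 𝓢(EuclideanSpace ℝ (Fin d), ℂ)) (hg : g ≠ 0) :
    ¬ IsBoundedOn g p q (modulationSpace g p q) chirpMul ∧
    ¬ IsBoundedOn g p q (schwartzClosure g p q) chirpMul := by
  constructor
  · rintro ⟨C, hC⟩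
    obtain ⟨f, hf, hlt⟩ := exists_modNorm_lt_modNorm_chirpMul hd hp hq hpq hg C
    exact (hC _ hf).not_gt hlt
  · rintro ⟨C, hC⟩
    obtain ⟨f, hf, hlt⟩ := exists_modNorm_lt_modNorm_chirpMul hd hp hq hpq hg C
    exact (hC _ (toDist_mem_schwartzClosure hf)).not_gt hlt

theorem proposition7p1 (d : ℕ) (hd : 1 ≤ d) (p q : ℝ≥0∞) (hp : 1 ≤ p) (hq : 1 ≤ q) (hpq : p ≠ q)
    (g : 𝓢(EuclideanSpace ℝ (Fin d), ℂ)) (hg : g ≠ 0) :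
    ¬ ModulationSpaces.IsBoundedOn g p q (ModulationSpaces.modulationSpace g p q)
        ModulationSpaces.chirpMul ∧
    ¬ ModulationSpaces.IsBoundedOn g p q (ModulationSpaces.schwartzClosure g p q)
        ModulationSpaces.chirpMul := by
  exact proposition7p1_general d hd p q (zero_lt_one.trans_le hp).ne'
    (zero_lt_one.trans_le hq).ne' hpq g hg
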